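/- Let $\mathcal Z$ be a measurable space whose diagonal is measurable in $\mathcal Z\times\mathcal Z$ (for instance a standard Borel space), let $n\ge 0$, and let the permutation group $\Pi(n+1)$ act on $\mathcal Z^{n+1}$ by permuting coordinates. Write $O(z^{n+1})$ for the orbit of $z^{n+1}=(z_1,\dots,z_{n+1})$, $\mathrm{Unif}(O)$ for the law of a uniformly random permutation of a fixed element of the orbit $O$, and $\mathrm{Unif}[O]=\frac1{n+1}\sum_{i=1}^{n+1}\delta_{z_i}$ for $O=O(z^{n+1})$. The set of orbits carries the quotient $\sigma$-algebra. An e-value for exchangeability is a measurable map $\varepsilon:\mathcal Z^{n+1}\to[0,\infty]$ with $\mathrm E^P[\varepsilon]\le 1$ for every exchangeable probability measure $P$ on $\mathcal Z^{n+1}$. It is $U$-optimal against a probability measure $Q$ on $\mathcal Z^{n+1}$ if $\mathrm E^Q[U(\varepsilon')]\le \mathrm E^Q[U(\varepsilon)]$ for every e-value $\varepsilon'$ for exchangeability. We say that $Z^n$ is exchangeable under $Q$ if $Q$ is invariant under all permutations of the first $n$ coordinates (with the last coordinate fixed). Let $U:[0,\infty]\to[0,\infty]$ be nondecreasing, with $U(0)=0$,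 and finite and concave on $[0,\infty)$, differentiable on $(0,\infty)$, with $U'$ continuous and strictly decreasing on $(0,\infty)$, $\lim_{x\downarrow 0}U'(x)=\infty$ and $\lim_{x\to\infty}U'(x)=0$. Put $U'(0)=\infty$ and $U'(\infty)=0$, so that $U'$ is a bijection of $[0,\infty]$ with inverse $(U')^{-1}$. (i) For every probability measure $Q$ under which $Z^n$ is exchangeable there is a Markov kernel $O\mapsto Q^{Z_{n+1}\mid O}$ with $Q^{Z_{n+1}\mid O}\ll \mathrm{Unif}[O]$ for every $O$ which is the conditional distribution under $Q$ of $Z_{n+1}$ given the orbit $O(Z^{n+1})$. (ii) Let $O\mapsto Q^{Z_{n+1}\mid O}$ be any Markov kernel from orbits to $\mathcal Z$ with $Q^{Z_{n+1}\mid O}\ll \mathrm{Unif}[O]$ for every $O$, and let $$\mathrm{LR}^{Z_{n+1}\mid O}=\frac{dQ^{Z_{n+1}\mid O}}{d\,\mathrm{Unif}[O]}.$$ For every probability measure $\nu$ on the set of orbits there is exactly one probability measure $Q$ on $\mathcal Z^{n+1}$ under which $Z^n$ is exchangeable, $O(Z^{n+1})$ has law $\nu$, and $Z_{n+1}$ has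 conditional distribution $Q^{Z_{n+1}\mid O}$ given the orbit $O$. There are constants $\lambda^O\in[0,\infty)$ such that $$\varepsilon^U(z^{n+1})=(U')^{-1}\!\left(\frac{\lambda^{O(z^{n+1})}}{\mathrm{LR}^{Z_{n+1}\mid O(z^{n+1})}(z_{n+1})}\right)\qquad(\text{with } a/0=\infty \text{ for } a>0)$$ satisfies $\mathrm E^{\mathrm{Unif}(O)}[\varepsilon^U]=1$ for every orbit $O$. For any such constants, $\lambda^O>0$ for every $O$, $\varepsilon^U$ is an e-value for exchangeability, and it is $U$-optimal simultaneously against every probability measure $Q$ under which $Z^n$ is exchangeable and $Z_{n+1}$ has conditional distribution $Q^{Z_{n+1}\mid O}$ given the orbit $O$, whatever the law of the orbit (the mixture over orbits) and whatever the exchangeable law of $Z^n$. -/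

import Mathlib

open MeasureTheory ProbabilityTheory Filter Topology
open scoped ENNReal NNReal

noncomputable section

namespace FuzzyConformal

/-- Two tuples are equivalent when one is a permutation of the other. -/
def orbitSetoid (n : ℕ) (Z : Type*) : Setoid (Fin (n + 1) → Z) where
  r z w := ∃ π : Equiv.Perm (Fin (n + 1)), w = z ∘ π
  iseqv :=
    { refl := fun _ => ⟨1, rfl⟩
      symm := by
        rintro z w ⟨π, rfl⟩
        exact ⟨π⁻¹, by ext i; simp⟩
      trans := by
        rintro z w v ⟨π, rfl⟩ ⟨ρ, rfl⟩
        exact ⟨π * ρ, rfl⟩ }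

/-- The set of orbits of the permutation group on `(n + 1)`-tuples. It carries the quotient
σ-algebra, which is the σ-algebra of permutation-invariant measurable sets of tuples. -/
abbrev Orbit (n : ℕ) (Z : Type*) : Type _ := Quotient (orbitSetoid n Z)

/-- The orbit `O(z)` of a tuple `z`. -/
def orbit {n : ℕ} {Z : Type*} (z : Fin (n + 1) → Z) : Orbit n Z := Quotient.mk _ z

/-- The orbit representative `[z]` of the orbit `O`. -/
def rep {n : ℕ} {Z : Type*} (O : Orbit n Z) : Fin (n + 1) → Z := Quotient.out O

variable {Z : Type*} [MeasurableSpace Z] {n : ℕ}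

/-- The law of the tuple is invariant under all permutations of the `n + 1` coordinates. -/
def Exchangeable (P : Measure (Fin (n + 1) → Z)) : Prop :=
  ∀ π : Equiv.Perm (Fin (n + 1)), P.map (fun z => z ∘ π) = P

/-- Exchangeability of the first `n` coordinates: the law of the whole tuple is invariant under
all permutations of the first `n` coordinates, the last one staying in place. -/
def FirstExchangeable (Q : Measure (Fin (n + 1) → Z)) : Prop :=
  ∀ π : Equiv.Perm (Fin (n + 1)), π (Fin.last n) = Fin.last n → Q.map (fun z => z ∘ π) = Q

/-- `Unif(O)`: the uniform distribution on the orbit `O`, the law of a uniformly random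
permutation of the representative. -/
def unifOrbit (O : Orbit n Z) : Measure (Fin (n + 1) → Z) :=
  ((Nat.factorial (n + 1) : ℝ≥0∞))⁻¹ •
    ∑ π : Equiv.Perm (Fin (n + 1)), Measure.dirac (rep O ∘ π)

/-- The uniform distribution on the `n + 1` entries of the tuple `[z]`, counted with
multiplicity. -/
def unifEntries (O : Orbit n Z) : Measure Z :=
  ((n + 1 : ℕ) : ℝ≥0∞)⁻¹ • ∑ i : Fin (n + 1), Measure.dirac (rep O i)

/-- An e-value for exchangeability: a `[0, ∞]`-valued statistic with expectation at most one
under every exchangeable distribution. -/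
structure IsEValue (ε : (Fin (n + 1) → Z) → ℝ≥0∞) : Prop where
  measurable : Measurable ε
  valid : ∀ P : Measure (Fin (n + 1) → Z), IsProbabilityMeasure P → Exchangeable P →
    ∫⁻ z, ε z ∂P ≤ 1

/-- `ε` is an e-value for exchangeability that maximizes the expected utility under `Q` among
all e-values for exchangeability. -/
def IsOptimalEValue (U : ℝ≥0∞ → ℝ≥0∞) (Q : Measure (Fin (n + 1) → Z))
    (ε : (Fin (n + 1) → Z) → ℝ≥0∞) : Prop :=
  IsEValue ε ∧ ∀ ε' : (Fin (n + 1) → Z) → ℝ≥0∞, IsEValue ε' →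
    ∫⁻ z, U (ε' z) ∂Q ≤ ∫⁻ z, U (ε z) ∂Q

/-- The restriction of `U : [0, ∞] → [0, ∞]` to the finite half-line, as a real function. -/
def realUtility (U : ℝ≥0∞ → ℝ≥0∞) (x : ℝ) : ℝ := (U (ENNReal.ofReal x)).toReal

/-- The regularity conditions on a utility function `U : [0, ∞] → [0, ∞]`. -/
structure RegularUtility (U : ℝ≥0∞ → ℝ≥0∞) : Prop where
  map_zero : U 0 = 0
  mono : Monotone U
  finite : ∀ x, x ≠ ∞ → U x ≠ ∞
  concave : ConcaveOn ℝ (Set.Ici 0) (realUtility U)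
  differentiable : DifferentiableOn ℝ (realUtility U) (Set.Ioi 0)
  deriv_continuous : ContinuousOn (deriv (realUtility U)) (Set.Ioi 0)
  deriv_strictAnti : StrictAntiOn (deriv (realUtility U)) (Set.Ioi 0)
  deriv_zero : Tendsto (deriv (realUtility U)) (𝓝[>] 0) atTop
  deriv_top : Tendsto (deriv (realUtility U)) atTop (𝓝 0)

/-- The derivative `U'` on `[0, ∞]`, with `U'(0) = ∞` and `U'(∞) = 0`. -/
def extDeriv (U : ℝ≥0∞ → ℝ≥0∞) (x : ℝ≥0∞) : ℝ≥0∞ :=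
  if x = 0 then ∞ else if x = ∞ then 0 else ENNReal.ofReal (deriv (realUtility U) x.toReal)

/-- The inverse `(U')⁻¹` of `U' : [0, ∞] → [0, ∞]`. -/
def invDeriv (U : ℝ≥0∞ → ℝ≥0∞) : ℝ≥0∞ → ℝ≥0∞ := Function.invFun (extDeriv U)

/-- The likelihood ratio of the last observation on an orbit: the density of `κ O`, the
distribution of the last observation on the orbit `O` under the alternative, with respect to
the uniform distribution on the entries of the orbit. -/
def lastLR (κ : Kernel (Orbit n Z) Z) (O : Orbit n Z) (x : Z) : ℝ≥0∞ :=
  (κ O).rnDeriv (unifEntries O) x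

/-- The e-value `(U')⁻¹(lam(O(z)) / LR(z_{n+1}))`; here `a / 0 = ∞` for `a > 0`. -/
def utilityEValue (U : ℝ≥0∞ → ℝ≥0∞) (κ : Kernel (Orbit n Z) Z) (lam : Orbit n Z → ℝ≥0)
    (z : Fin (n + 1) → Z) : ℝ≥0∞ :=
  invDeriv U ((lam (orbit z) : ℝ≥0∞) / lastLR κ (orbit z) (z (Fin.last n)))

/-- `lam` normalizes the e-value to have expectation exactly one on every orbit. -/
def IsNormalizer (U : ℝ≥0∞ → ℝ≥0∞) (κ : Kernel (Orbit n Z) Z) (lam : Orbit n Z → ℝ≥0) : Prop :=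
  ∀ O : Orbit n Z, ∫⁻ z, utilityEValue U κ lam z ∂(unifOrbit O) = 1

/-- An orbit-dependent distribution of the last observation over the entries of the orbit. -/
def IsOrbitLaw (κ : Kernel (Orbit n Z) Z) : Prop :=
  IsMarkovKernel κ ∧ ∀ O, κ O ≪ unifEntries O

/-- `Q` is a distribution of the tuple under which the first `n` observations are exchangeable
and the last observation has conditional distribution `κ O` given the orbit `O`. -/
structure IsAlternative (κ : Kernel (Orbit n Z) Z) (Q : Measure (Fin (n + 1) → Z)) : Prop where
  prob : IsProbabilityMeasure Q
  first : FirstExchangeable Q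
  cond : HasCondDistrib (fun z : Fin (n + 1) → Z => z (Fin.last n)) orbit κ Q

end FuzzyConformal

end

noncomputable section

namespace FuzzyConformal

/-! ### Orbits, the uniform laws on them, and exchangeability. -/

section Orbits

variable {Z : Type*} {n : ℕ}

/-! Everything decouples over orbits. Exchangeable laws are mixtures of the laws `Unif(O)`, so an
e-value is a measurable statistic whose mean is at most one on every orbit. An alternative with
orbit law `ν` has density `LR(z_{n+1})` with respect to the mixture of the `Unif(O)` under `ν`
(`IsAlternative.eq_alternative`). Hence it is enough to maximize, on each orbit separately, the mean
of `LR * U(ε)` subject to `ε` having mean at most one; `ν` plays no role.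

On one orbit this is a finite concave problem. The Lagrange condition `LR * U'(ε) = λ` gives the
stated e-value, and the tangent inequality `RegularUtility.mul_add_le` proves it optimal. The
multiplier exists by the intermediate value theorem; strict monotonicity determines it, which is
also why it is measurable in the orbit.

For the correspondence between `Q` and its conditional law, a function symmetric in the first `n`
entries factors measurably through the orbit and the last entry (`exists_measurable_orbit_last`);
this gives uniqueness. Existence of the conditional law in (i) comes from the density of `Q` with
respect to its symmetrization. -/

lemma orbit_comp_perm (z : Fin (n + 1) → Z) (π : Equiv.Perm (Fin (n + 1))) :
    orbit (z ∘ π) = orbit z :=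
  (Quotient.sound ⟨π, rfl⟩ : orbit z = orbit (z ∘ π)).symm

lemma orbit_rep (O : Orbit n Z) : orbit (rep O) = O := Quotient.out_eq O

lemma exists_rep_orbit_eq (z : Fin (n + 1) → Z) :
    ∃ π : Equiv.Perm (Fin (n + 1)), rep (orbit z) = z ∘ π :=
  Quotient.exact (orbit_rep (orbit z)).symm

lemma orbit_surjective : Function.Surjective (orbit : (Fin (n + 1) → Z) → Orbit n Z) :=
  fun O => ⟨rep O, orbit_rep O⟩

/-- A permutation moving an equal entry into the last place may be replaced by one fixing the
last place. -/
lemma exists_perm_fix_last (z : Fin (n + 1) → Z) (π : Equiv.Perm (Fin (n + 1)))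
    (h : z (π (Fin.last n)) = z (Fin.last n)) :
    ∃ σ : Equiv.Perm (Fin (n + 1)), σ (Fin.last n) = Fin.last n ∧ z ∘ π = z ∘ σ := by
  refine ⟨Equiv.swap (π (Fin.last n)) (Fin.last n) * π, by simp, ?_⟩
  ext i
  simp only [Function.comp_apply, Equiv.Perm.mul_apply]
  rw [Equiv.swap_apply_def]
  split_ifs with h1 h2
  · rw [h1, h]
  · rw [h2, h]
  · rfl

/-- Composing with a transposition shows that the sum over `π` of `g (π i)` does not depend on `i`;
summing over `i` and exchanging sums gives the count. This makes the last entry uniform on the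
entries under `Unif(O)`. -/
lemma sum_perm_apply_last (g : Fin (n + 1) → ℝ≥0∞) :
    ((n + 1).factorial : ℝ≥0∞)⁻¹ * ∑ π : Equiv.Perm (Fin (n + 1)), g (π (Fin.last n)) =
      ((n + 1 : ℕ) : ℝ≥0∞)⁻¹ * ∑ i, g i := by
  have key : ((n + 1 : ℕ) : ℝ≥0∞) * ∑ π : Equiv.Perm (Fin (n + 1)), g (π (Fin.last n)) =
      ((n + 1).factorial : ℝ≥0∞) * ∑ i, g i := by
    have h1 : ∀ i : Fin (n + 1), ∑ π : Equiv.Perm (Fin (n + 1)), g (π i) =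
        ∑ π : Equiv.Perm (Fin (n + 1)), g (π (Fin.last n)) := fun i =>
      Fintype.sum_equiv (Equiv.mulRight (Equiv.swap i (Fin.last n))) _ _ (by simp)
    have h2 : ∑ i : Fin (n + 1), ∑ π : Equiv.Perm (Fin (n + 1)), g (π i) =
        ∑ π : Equiv.Perm (Fin (n + 1)), ∑ i, g i := by
      rw [Finset.sum_comm]
      exact Finset.sum_congr rfl fun π _ => Equiv.sum_comp π g
    simp only [h1, Finset.sum_const, Finset.card_univ, Fintype.card_fin, Fintype.card_perm,
      nsmul_eq_mul] at h2
    exact h2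
  have hn : ((n + 1 : ℕ) : ℝ≥0∞) ≠ 0 := by simp
  have hf : ((n + 1).factorial : ℝ≥0∞) ≠ 0 := by simp [Nat.factorial_ne_zero]
  have ht := ENNReal.natCast_ne_top
  rw [← one_mul (∑ π : Equiv.Perm (Fin (n + 1)), g (π (Fin.last n))),
    ← ENNReal.inv_mul_cancel hn (ht _), mul_assoc, key, mul_left_comm, ← mul_assoc _ _ (∑ i, g i),
    ENNReal.inv_mul_cancel hf (ht _), one_mul]

variable [MeasurableSpace Z]

lemma measurable_orbit : Measurable (orbit : (Fin (n + 1) → Z) → Orbit n Z) :=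
  measurable_quotient_mk''

lemma measurable_comp_perm (π : Equiv.Perm (Fin (n + 1))) :
    Measurable (fun z : Fin (n + 1) → Z => z ∘ π) := by
  unfold Function.comp; fun_prop

lemma measurable_of_comp_orbit {β : Type*} [MeasurableSpace β] {f : Orbit n Z → β}
    (h : Measurable fun z => f (orbit z)) : Measurable f :=
  measurable_from_quotient.2 h

lemma measurable_orbit_last :
    Measurable (fun z : Fin (n + 1) → Z => (orbit z, z (Fin.last n))) :=
  measurable_orbit.prodMk (measurable_pi_apply _)

lemma unifOrbit_orbit (z : Fin (n + 1) → Z) :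
    unifOrbit (orbit z) = ((Nat.factorial (n + 1) : ℝ≥0∞))⁻¹ •
      ∑ π : Equiv.Perm (Fin (n + 1)), Measure.dirac (z ∘ π) := by
  obtain ⟨ρ, hρ⟩ := exists_rep_orbit_eq z
  rw [unifOrbit, hρ]
  congr 1
  exact Fintype.sum_equiv (Equiv.mulLeft ρ) _ _ (fun π => rfl)

lemma unifEntries_orbit (z : Fin (n + 1) → Z) :
    unifEntries (orbit z) = ((n + 1 : ℕ) : ℝ≥0∞)⁻¹ • ∑ i, Measure.dirac (z i) := by
  obtain ⟨ρ, hρ⟩ := exists_rep_orbit_eq z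
  rw [unifEntries, hρ]
  congr 1
  exact Fintype.sum_equiv ρ _ _ (fun π => rfl)

instance isProbabilityMeasure_unifOrbit (O : Orbit n Z) : IsProbabilityMeasure (unifOrbit O) := by
  constructor
  have hf : ((n + 1).factorial : ℝ≥0∞) ≠ 0 := by simp [Nat.factorial_ne_zero]
  simp only [unifOrbit, Measure.smul_apply, Measure.finsetSum_apply, measure_univ,
    Finset.sum_const, Finset.card_univ, Fintype.card_perm, Fintype.card_fin, smul_eq_mul,
    nsmul_eq_mul, mul_one]
  exact ENNReal.inv_mul_cancel hf (ENNReal.natCast_ne_top _)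

instance isProbabilityMeasure_unifEntries (O : Orbit n Z) :
    IsProbabilityMeasure (unifEntries O) := by
  constructor
  simp only [unifEntries, Measure.smul_apply, Measure.finsetSum_apply, measure_univ,
    Finset.sum_const, Finset.card_univ, Fintype.card_fin, smul_eq_mul,
    nsmul_eq_mul, mul_one]
  exact ENNReal.inv_mul_cancel (by simp) (ENNReal.natCast_ne_top _)

/-- The kernel `O ↦ Unif(O)`. -/
def unifKernel (n : ℕ) (Z : Type*) [MeasurableSpace Z] : Kernel (Orbit n Z) (Fin (n + 1) → Z) where
  toFun := unifOrbit
  measurable' := by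
    refine measurable_of_comp_orbit (Measure.measurable_of_measurable_coe _ fun s hs => ?_)
    simp only [unifOrbit_orbit, Measure.smul_apply, Measure.finsetSum_apply, smul_eq_mul,
      Measure.dirac_apply' _ hs]
    refine Measurable.const_mul (Finset.measurable_sum _ fun π _ => ?_) _
    exact (measurable_one.indicator hs).comp (measurable_comp_perm π)

lemma unifKernel_apply (O : Orbit n Z) : unifKernel n Z O = unifOrbit O := rfl

instance isMarkovKernel_unifKernel : IsMarkovKernel (unifKernel n Z) :=
  ⟨fun O => isProbabilityMeasure_unifOrbit O⟩

lemma measurable_lintegral_unifOrbit {f : (Fin (n + 1) → Z) → ℝ≥0∞} (hf : Measurable f) :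
    Measurable fun O => ∫⁻ w, f w ∂(unifOrbit O) :=
  hf.lintegral_kernel (κ := unifKernel n Z)

lemma exchangeable_unifOrbit (O : Orbit n Z) : Exchangeable (unifOrbit O) := by
  intro ρ
  rw [unifOrbit, Measure.map_smul, Measure.map_finset_sum (measurable_comp_perm ρ).aemeasurable]
  congr 1
  simp_rw [Measure.map_dirac' (measurable_comp_perm ρ)]
  exact Fintype.sum_equiv (Equiv.mulRight ρ) _ _ (fun π => rfl)

lemma IsEValue.lintegral_unifOrbit_le {ε : (Fin (n + 1) → Z) → ℝ≥0∞} (h : IsEValue ε)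
    (O : Orbit n Z) : ∫⁻ z, ε z ∂(unifOrbit O) ≤ 1 :=
  h.valid _ inferInstance (exchangeable_unifOrbit O)

/-- The mixture of the uniform distributions on orbits with mixing law `ν`. -/
def orbitMixture (ν : Measure (Orbit n Z)) : Measure (Fin (n + 1) → Z) :=
  ν.bind (unifKernel n Z)

lemma lintegral_orbitMixture (ν : Measure (Orbit n Z)) {f : (Fin (n + 1) → Z) → ℝ≥0∞}
    (hf : Measurable f) :
    ∫⁻ z, f z ∂(orbitMixture ν) = ∫⁻ O, ∫⁻ w, f w ∂(unifOrbit O) ∂ν :=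
  Measure.lintegral_bind (unifKernel n Z).aemeasurable hf.aemeasurable

lemma exchangeable_orbitMixture (ν : Measure (Orbit n Z)) : Exchangeable (orbitMixture ν) := by
  intro π
  refine Measure.ext_of_lintegral _ fun f hf => ?_
  rw [lintegral_map hf (measurable_comp_perm π), lintegral_orbitMixture ν hf,
    lintegral_orbitMixture ν (f := fun z => f (z ∘ π)) (hf.comp (measurable_comp_perm π))]
  refine lintegral_congr fun O => ?_
  conv_rhs => rw [← exchangeable_unifOrbit O π, lintegral_map hf (measurable_comp_perm π)]

/-- A measure whose integrals of functions of the orbit and the last entry are those of `ν ⊗ₘ κ`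
has `ν` as its law of the orbit and `κ` as conditional law of the last entry. -/
lemma condDistrib_of_lintegral {κ : Kernel (Orbit n Z) Z} [IsMarkovKernel κ]
    {ν : Measure (Orbit n Z)} [IsProbabilityMeasure ν] {Q : Measure (Fin (n + 1) → Z)}
    (h : ∀ F : Orbit n Z × Z → ℝ≥0∞, Measurable F →
      ∫⁻ z, F (orbit z, z (Fin.last n)) ∂Q = ∫⁻ O, ∫⁻ x, F (O, x) ∂(κ O) ∂ν) :
    IsProbabilityMeasure Q ∧ Q.map orbit = ν ∧
      HasCondDistrib (fun z : Fin (n + 1) → Z => z (Fin.last n)) orbit κ Q := by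
  have hmap : Q.map orbit = ν := by
    refine Measure.ext_of_lintegral _ fun f hf => ?_
    rw [lintegral_map hf measurable_orbit, h (fun p => f p.1) (hf.comp measurable_fst)]
    simp
  refine ⟨⟨?_⟩, hmap, ⟨measurable_orbit_last.aemeasurable, ?_⟩⟩
  · simpa using h (fun _ => 1) measurable_const
  · refine Measure.ext_of_lintegral _ fun f hf => ?_
    rw [lintegral_map hf measurable_orbit_last, h f hf, hmap, Measure.lintegral_compProd hf]

variable [MeasurableSingletonClass Z]

lemma lintegral_unifOrbit_orbit (z : Fin (n + 1) → Z) (f : (Fin (n + 1) → Z) → ℝ≥0∞) :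
    ∫⁻ w, f w ∂(unifOrbit (orbit z)) =
      ((Nat.factorial (n + 1) : ℝ≥0∞))⁻¹ * ∑ π : Equiv.Perm (Fin (n + 1)), f (z ∘ π) := by
  simp [unifOrbit_orbit, lintegral_smul_measure]

/-- The integral is a finite sum over tuples in `O`, so no measurability is needed and `orbit w` may
be treated as the constant `O`. -/
lemma lintegral_unifOrbit_mono {O : Orbit n Z} {f g : (Fin (n + 1) → Z) → ℝ≥0∞}
    (h : ∀ w, orbit w = O → f w ≤ g w) :
    ∫⁻ w, f w ∂(unifOrbit O) ≤ ∫⁻ w, g w ∂(unifOrbit O) := by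
  obtain ⟨z, rfl⟩ := orbit_surjective O
  simp only [lintegral_unifOrbit_orbit]
  gcongr with π
  exact h _ (orbit_comp_perm z π)

lemma lintegral_unifOrbit_congr {O : Orbit n Z} {f g : (Fin (n + 1) → Z) → ℝ≥0∞}
    (h : ∀ w, orbit w = O → f w = g w) :
    ∫⁻ w, f w ∂(unifOrbit O) = ∫⁻ w, g w ∂(unifOrbit O) :=
  le_antisymm (lintegral_unifOrbit_mono fun w hw => (h w hw).le)
    (lintegral_unifOrbit_mono fun w hw => (h w hw).ge)

lemma lintegral_unifEntries_orbit (z : Fin (n + 1) → Z) (g : Z → ℝ≥0∞) :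
    ∫⁻ x, g x ∂(unifEntries (orbit z)) = ((n + 1 : ℕ) : ℝ≥0∞)⁻¹ * ∑ i, g (z i) := by
  simp only [unifEntries_orbit, lintegral_smul_measure, lintegral_finsetSum_measure,
    lintegral_dirac, smul_eq_mul]

lemma lintegral_unifOrbit_last (O : Orbit n Z) (g : Z → ℝ≥0∞) :
    ∫⁻ w, g (w (Fin.last n)) ∂(unifOrbit O) = ∫⁻ x, g x ∂(unifEntries O) := by
  obtain ⟨z, rfl⟩ := orbit_surjective O
  rw [lintegral_unifOrbit_orbit, lintegral_unifEntries_orbit]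
  exact sum_perm_apply_last fun i => g (z i)

lemma map_last_unifOrbit (O : Orbit n Z) :
    (unifOrbit O).map (fun w => w (Fin.last n)) = unifEntries O := by
  refine Measure.ext_of_lintegral _ fun f hf => ?_
  rw [lintegral_map hf (measurable_pi_apply _), lintegral_unifOrbit_last]

/-- Averages the invariance of `P` over all permutations; validity of an e-value thereby reduces to
its means on orbits. -/
lemma Exchangeable.lintegral_eq {P : Measure (Fin (n + 1) → Z)} (hP : Exchangeable P)
    {f : (Fin (n + 1) → Z) → ℝ≥0∞} (hf : Measurable f) :
    ∫⁻ z, f z ∂P = ∫⁻ z, ∫⁻ w, f w ∂(unifOrbit (orbit z)) ∂P := by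
  simp only [lintegral_unifOrbit_orbit]
  have hm : ∀ π : Equiv.Perm (Fin (n + 1)), Measurable fun z => f (z ∘ π) := fun π =>
    hf.comp (measurable_comp_perm π)
  rw [lintegral_const_mul _ (Finset.measurable_sum _ fun π _ => hm π),
    lintegral_finsetSum _ fun π _ => hm π]
  have h1 : ∀ π : Equiv.Perm (Fin (n + 1)), ∫⁻ z, f (z ∘ π) ∂P = ∫⁻ z, f z ∂P := fun π => by
    rw [← lintegral_map hf (measurable_comp_perm π), hP π]
  have hf : ((n + 1).factorial : ℝ≥0∞) ≠ 0 := by simp [Nat.factorial_ne_zero]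
  simp only [h1, Finset.sum_const, Finset.card_univ, Fintype.card_perm, Fintype.card_fin,
    nsmul_eq_mul]
  rw [← mul_assoc, ENNReal.inv_mul_cancel hf (ENNReal.natCast_ne_top _), one_mul]

/-- A function with finite mean on the orbit of `z` is finite at `z`. -/
lemma ne_top_of_lintegral_unifOrbit_ne_top {f : (Fin (n + 1) → Z) → ℝ≥0∞} {z : Fin (n + 1) → Z}
    (h : ∫⁻ w, f w ∂(unifOrbit (orbit z)) ≠ ∞) : f z ≠ ∞ := by
  intro hz
  apply h
  rw [lintegral_unifOrbit_orbit]
  have : ∑ π : Equiv.Perm (Fin (n + 1)), f (z ∘ π) = ∞ :=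
    ENNReal.sum_eq_top.2 ⟨1, Finset.mem_univ _, hz⟩
  rw [this, ENNReal.mul_top]
  simp

lemma lintegral_orbitMixture_orbit (ν : Measure (Orbit n Z)) {F : Orbit n Z → ℝ≥0∞}
    (hF : Measurable F) : ∫⁻ z, F (orbit z) ∂(orbitMixture ν) = ∫⁻ O, F O ∂ν := by
  rw [lintegral_orbitMixture ν (f := fun z => F (orbit z)) (hF.comp measurable_orbit)]
  refine lintegral_congr fun O => ?_
  rw [lintegral_unifOrbit_congr (g := fun _ => F O) fun w hw => by rw [hw]]
  simp

instance isProbabilityMeasure_orbitMixture (ν : Measure (Orbit n Z)) [IsProbabilityMeasure ν] :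
    IsProbabilityMeasure (orbitMixture ν) := by
  constructor
  have := lintegral_orbitMixture_orbit ν (F := fun _ => 1) measurable_const
  simpa using this

end Orbits

/-! ### The inverse marginal utility and the Lagrange multiplier. -/

section Utility

variable {U : ℝ≥0∞ → ℝ≥0∞}

lemma RegularUtility.deriv_pos (hU : RegularUtility U) {x : ℝ} (hx : 0 < x) :
    0 < deriv (realUtility U) x := by
  have h1 : deriv (realUtility U) (x + 1) < deriv (realUtility U) x :=
    hU.deriv_strictAnti hx (Set.mem_Ioi.2 (by linarith)) (by linarith)
  refine lt_of_le_of_lt ?_ h1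
  refine le_of_tendsto hU.deriv_top ?_
  filter_upwards [eventually_gt_atTop (x + 1)] with y hy
  exact (hU.deriv_strictAnti (Set.mem_Ioi.2 (by linarith)) (Set.mem_Ioi.2 (by linarith)) hy).le

lemma RegularUtility.exists_deriv_eq (hU : RegularUtility U) {c : ℝ} (hc : 0 < c) :
    ∃ x, 0 < x ∧ deriv (realUtility U) x = c := by
  have := isPreconnected_Ioi.intermediate_value_Ioi (l₁ := atTop) (l₂ := 𝓝[>] (0 : ℝ))
    (le_principal_iff.2 (Ioi_mem_atTop 0)) (le_principal_iff.2 self_mem_nhdsWithin)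
    hU.deriv_continuous hU.deriv_top hU.deriv_zero
  obtain ⟨x, hx, h⟩ := this hc
  exact ⟨x, hx, h⟩

@[simp] lemma extDeriv_zero : extDeriv U 0 = ∞ := by simp [extDeriv]

@[simp] lemma extDeriv_top : extDeriv U ∞ = 0 := by simp [extDeriv]

lemma extDeriv_ofReal {x : ℝ} (hx : 0 < x) :
    extDeriv U (ENNReal.ofReal x) = ENNReal.ofReal (deriv (realUtility U) x) := by
  have : ENNReal.ofReal x ≠ 0 := by simpa using hx
  simp [extDeriv, this, ENNReal.toReal_ofReal hx.le]

lemma RegularUtility.extDeriv_strictAnti (hU : RegularUtility U) : StrictAnti (extDeriv U) := by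
  intro a b hab
  have hb0 : 0 < b := bot_le.trans_lt hab
  have ha : a ≠ ∞ := hab.ne_top
  rcases eq_or_ne a 0 with rfl | ha0
  · rcases eq_or_ne b ∞ with rfl | hb
    · simp
    · simp [extDeriv, hb0.ne', hb]
  · have hap : 0 < a.toReal := ENNReal.toReal_pos ha0 ha
    rcases eq_or_ne b ∞ with rfl | hb
    · simp [extDeriv, ha0, ha, hU.deriv_pos hap]
    · have hlt : a.toReal < b.toReal := (ENNReal.toReal_lt_toReal ha hb).2 hab
      simp only [extDeriv, ha0, ha, hb0.ne', hb, if_false]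
      exact (ENNReal.ofReal_lt_ofReal_iff (hU.deriv_pos hap)).2
        (hU.deriv_strictAnti hap (hap.trans hlt) hlt)

lemma RegularUtility.extDeriv_surjective (hU : RegularUtility U) :
    Function.Surjective (extDeriv U) := by
  intro c
  rcases eq_or_ne c 0 with rfl | hc0
  · exact ⟨∞, extDeriv_top⟩
  rcases eq_or_ne c ∞ with rfl | hc
  · exact ⟨0, extDeriv_zero⟩
  obtain ⟨x, hx, h⟩ := hU.exists_deriv_eq (ENNReal.toReal_pos hc0 hc)
  exact ⟨ENNReal.ofReal x, by rw [extDeriv_ofReal hx, h, ENNReal.ofReal_toReal hc]⟩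

lemma RegularUtility.extDeriv_invDeriv (hU : RegularUtility U) (c : ℝ≥0∞) :
    extDeriv U (invDeriv U c) = c :=
  Function.invFun_eq (hU.extDeriv_surjective c)

lemma RegularUtility.invDeriv_extDeriv (hU : RegularUtility U) (x : ℝ≥0∞) :
    invDeriv U (extDeriv U x) = x :=
  Function.leftInverse_invFun hU.extDeriv_strictAnti.injective x

lemma RegularUtility.invDeriv_zero (hU : RegularUtility U) : invDeriv U 0 = ∞ := by
  rw [← extDeriv_top (U := U), hU.invDeriv_extDeriv]

lemma RegularUtility.invDeriv_top (hU : RegularUtility U) : invDeriv U ∞ = 0 := by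
  rw [← extDeriv_zero (U := U), hU.invDeriv_extDeriv]

lemma RegularUtility.invDeriv_strictAnti (hU : RegularUtility U) : StrictAnti (invDeriv U) := by
  intro a b hab
  rw [← hU.extDeriv_strictAnti.lt_iff_gt, hU.extDeriv_invDeriv, hU.extDeriv_invDeriv]
  exact hab

/-- A monotone surjection between linear orders is continuous; passing to the order dual makes the
antitone inverse monotone. -/
lemma RegularUtility.continuous_invDeriv (hU : RegularUtility U) : Continuous (invDeriv U) := by
  have hmono : Monotone fun c => OrderDual.toDual (invDeriv U c) := fun a b hab =>
    hU.invDeriv_strictAnti.antitone hab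
  have hsurj : Function.Surjective fun c => OrderDual.toDual (invDeriv U c) := fun x =>
    ⟨extDeriv U (OrderDual.ofDual x), by simp [hU.invDeriv_extDeriv]⟩
  exact continuous_ofDual.comp (hmono.continuous_of_surjective hsurj)

lemma RegularUtility.measurable (hU : RegularUtility U) : Measurable U := hU.mono.measurable

lemma RegularUtility.tangent (hU : RegularUtility U) {x y : ℝ} (hx : 0 < x) (hy : 0 ≤ y) :
    realUtility U y ≤ realUtility U x + deriv (realUtility U) x * (y - x) := by
  have hd : HasDerivAt (realUtility U) (deriv (realUtility U) x) x :=
    (hU.differentiable.differentiableAt (Ioi_mem_nhds hx)).hasDerivAt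
  rcases lt_trichotomy x y with h | rfl | h
  · have := hU.concave.slope_le_of_hasDerivAt hx.le hy h hd
    rw [slope_def_field, div_le_iff₀ (by linarith)] at this
    linarith
  · simp
  · have := hU.concave.le_slope_of_hasDerivAt hy hx.le h hd
    rw [slope_def_field, le_div_iff₀ (by linarith)] at this
    linarith

/-- The tangent inequality at the point where `U'` equals `l / L`. -/
lemma RegularUtility.mul_add_le (hU : RegularUtility U) {l L y : ℝ≥0∞}
    (hl0 : l ≠ 0) (hl : l ≠ ∞) (hL : L ≠ ∞) (hy : y ≠ ∞) :
    U y * L + l * invDeriv U (l / L) ≤ U (invDeriv U (l / L)) * L + l * y := by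
  rcases eq_or_ne L 0 with rfl | hL0
  · simp [ENNReal.div_zero hl0, hU.invDeriv_top]
  set x := invDeriv U (l / L) with hx
  have hex : extDeriv U x = l / L := hU.extDeriv_invDeriv _
  have hx0 : x ≠ 0 := by
    intro h; rw [h, extDeriv_zero] at hex
    exact ENNReal.div_ne_top hl hL0 hex.symm
  have hxt : x ≠ ∞ := by
    intro h; rw [h, extDeriv_top] at hex
    exact (ENNReal.div_ne_zero.2 ⟨hl0, hL⟩) hex.symm
  have hxp : 0 < x.toReal := ENNReal.toReal_pos hx0 hxt
  have ht := hU.tangent hxp (ENNReal.toReal_nonneg (a := y))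
  have hdx : deriv (realUtility U) x.toReal = l.toReal / L.toReal := by
    simp only [extDeriv, hx0, hxt, if_false] at hex
    rw [← ENNReal.toReal_div, ← hex, ENNReal.toReal_ofReal (hU.deriv_pos hxp).le]
  simp only [hdx, realUtility, ENNReal.ofReal_toReal hxt, ENNReal.ofReal_toReal hy] at ht
  have hLp : 0 < L.toReal := ENNReal.toReal_pos hL0 hL
  have h2 : (U y).toReal * L.toReal + l.toReal * x.toReal ≤
      (U x).toReal * L.toReal + l.toReal * y.toReal := by
    have := mul_le_mul_of_nonneg_right ht hLp.le
    have e : ((U x).toReal + l.toReal / L.toReal * (y.toReal - x.toReal)) * L.toReal =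
      (U x).toReal * L.toReal + l.toReal * (y.toReal - x.toReal) := by
      field_simp
    linarith
  have hUx := hU.finite x hxt
  have hUy := hU.finite y hy
  rw [← ENNReal.toReal_le_toReal (by finiteness) (by finiteness),
    ENNReal.toReal_add (by finiteness) (by finiteness),
    ENNReal.toReal_add (by finiteness) (by finiteness)]
  simpa only [ENNReal.toReal_mul] using h2

/-- The mean of `(U')⁻¹(c / L i)` is strictly decreasing in `c` where finite. -/
lemma RegularUtility.sum_invDeriv_lt (hU : RegularUtility U) {ι : Type*} [Fintype ι]
    {L : ι → ℝ≥0∞} (hL : ∀ i, L i ≠ ∞) (hL0 : ∃ i, L i ≠ 0) {a b : ℝ≥0∞} (hab : a < b)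
    (hfin : ∑ i, invDeriv U (a / L i) ≠ ∞) :
    ∑ i, invDeriv U (b / L i) < ∑ i, invDeriv U (a / L i) := by
  obtain ⟨i, hi⟩ := hL0
  have hle : ∀ j, invDeriv U (b / L j) ≤ invDeriv U (a / L j) := fun j =>
    hU.invDeriv_strictAnti.antitone (ENNReal.div_le_div_right hab.le _)
  have hlt : invDeriv U (b / L i) < invDeriv U (a / L i) :=
    hU.invDeriv_strictAnti (ENNReal.div_lt_div_right hi (hL i) hab)
  classical
  rw [← Finset.add_sum_erase _ _ (Finset.mem_univ i),
    ← Finset.add_sum_erase _ (fun j => invDeriv U (a / L j)) (Finset.mem_univ i)] at *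
  refine ENNReal.add_lt_add_of_lt_of_le ?_ hlt (Finset.sum_le_sum fun j _ => hle j)
  exact ne_top_of_le_ne_top (ne_top_of_le_ne_top hfin le_add_self)
    (Finset.sum_le_sum fun j _ => hle j)

lemma RegularUtility.exists_sum_invDeriv_eq (hU : RegularUtility U) {ι : Type*} [Fintype ι]
    {L : ι → ℝ≥0∞} (hL : ∀ i, L i ≠ ∞) (hL0 : ∃ i, L i ≠ 0) {s : ℝ≥0∞} (hs0 : s ≠ 0)
    (hs : s ≠ ∞) : ∃ l : ℝ≥0, ∑ i, invDeriv U (l / L i) = s := by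
  classical
  obtain ⟨i, hi⟩ := hL0
  -- Terms with `L i = 0` are left out because `l / 0` jumps at `l = 0`. They vanish for `l > 0`, so
  -- they can be restored once the solution is known to be nonzero.
  set g : ℝ≥0∞ → ℝ≥0∞ := fun l => ∑ i with L i ≠ 0, invDeriv U (l / L i) with hg
  have hc : Continuous g := by
    refine continuous_finsetSum _ fun j hj => hU.continuous_invDeriv.comp ?_
    exact ENNReal.continuous_div_const _ (Finset.mem_filter.1 hj).2
  have h0 : g 0 = ∞ :=
    ENNReal.sum_eq_top.2 ⟨i, by simp [hi], by simp [hU.invDeriv_zero]⟩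
  have ht : g ∞ = 0 := by
    refine Finset.sum_eq_zero fun j _ => ?_
    rw [ENNReal.top_div_of_ne_top (hL j), hU.invDeriv_top]
  obtain ⟨l, hl⟩ : s ∈ Set.range g :=
    mem_range_of_exists_le_of_exists_ge hc ⟨∞, by simp [ht]⟩ ⟨0, by simp [h0]⟩
  have hlt : l ≠ ∞ := by rintro rfl; exact hs0 (hl.symm.trans ht)
  have hl0 : l ≠ 0 := by rintro rfl; exact hs (hl.symm.trans h0)
  lift l to ℝ≥0 using hlt
  refine ⟨l, ?_⟩
  simp only [← hl, hg]
  rw [Finset.sum_filter]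
  refine Finset.sum_congr rfl fun j _ => ?_
  split_ifs with h
  · rfl
  · rw [not_not.1 h, ENNReal.div_zero hl0, hU.invDeriv_top]

end Utility

/-! ### Alternatives, their densities, and conditional laws given the orbit. -/

section Alternatives

variable {Z : Type*} [MeasurableSpace Z] [MeasurableEq Z] {n : ℕ}

lemma measurable_kernel_singleton (κ : Kernel (Orbit n Z) Z) [IsSFiniteKernel κ] :
    Measurable fun p : Orbit n Z × Z => κ p.1 {p.2} := by
  have ht : MeasurableSet {q : (Orbit n Z × Z) × Z | q.2 = q.1.2} :=
    measurableSet_eq_fun measurable_snd (measurable_snd.comp measurable_fst)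
  exact Kernel.measurable_kernel_prodMk_left (κ := κ.comap Prod.fst measurable_fst) ht

open Classical in
/-- A function of the tuple that is symmetric in the first `n` entries is a measurable function
of the orbit and the last entry. -/
lemma exists_measurable_orbit_last {h : (Fin (n + 1) → Z) → ℝ≥0∞} (hm : Measurable h)
    (hinv : ∀ τ : Equiv.Perm (Fin (n + 1)), τ (Fin.last n) = Fin.last n →
      ∀ z, h (z ∘ τ) = h z) :
    ∃ H : Orbit n Z × Z → ℝ≥0∞, Measurable H ∧ ∀ z, H (orbit z, z (Fin.last n)) = h z := by
  have hi : Measurable fun q : (Orbit n Z × Z) × (Fin (n + 1) → Z) =>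
      if q.2 (Fin.last n) = q.1.2 then (1 : ℝ≥0∞) else 0 :=
    Measurable.ite (measurableSet_eq_fun ((measurable_pi_apply _).comp measurable_snd)
      (measurable_snd.comp measurable_fst)) measurable_const measurable_const
  let κ' : Kernel (Orbit n Z × Z) (Fin (n + 1) → Z) :=
    (unifKernel n Z).comap Prod.fst measurable_fst
  -- The witness is the mean of `h` under `Unif(O)` conditioned on the value of the last entry; by
  -- symmetry `h` is constant on that event.
  refine ⟨fun p => (∫⁻ w, h w * (if w (Fin.last n) = p.2 then 1 else 0) ∂(unifOrbit p.1)) /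
      ∫⁻ w, (if w (Fin.last n) = p.2 then 1 else 0) ∂(unifOrbit p.1), ?_, fun z => ?_⟩
  · exact Measurable.div
      (Measurable.lintegral_kernel_prod_right' (κ := κ') ((hm.comp measurable_snd).mul hi))
      (Measurable.lintegral_kernel_prod_right' (κ := κ') hi)
  · have h1 : ∫⁻ w, h w * (if w (Fin.last n) = z (Fin.last n) then 1 else 0)
          ∂(unifOrbit (orbit z)) =
        ∫⁻ w, h z * (if w (Fin.last n) = z (Fin.last n) then 1 else 0)
          ∂(unifOrbit (orbit z)) := by
      refine lintegral_unifOrbit_congr fun w hw => ?_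
      split_ifs with hl
      · obtain ⟨π, rfl⟩ := Quotient.exact hw.symm
        obtain ⟨σ, hσ, e⟩ := exists_perm_fix_last z π hl
        rw [e, hinv σ hσ]
      · simp
    have h2 : ∫⁻ w, (if w (Fin.last n) = z (Fin.last n) then (1 : ℝ≥0∞) else 0)
        ∂(unifOrbit (orbit z)) ≠ 0 := by
      rw [lintegral_unifOrbit_orbit]
      refine mul_ne_zero (by simp) fun h0 => ?_
      have := (Finset.sum_eq_zero_iff.1 h0) 1 (Finset.mem_univ _)
      simp at this
    have h3 : ∫⁻ w, (if w (Fin.last n) = z (Fin.last n) then (1 : ℝ≥0∞) else 0)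
        ∂(unifOrbit (orbit z)) ≠ ∞ := by
      refine ne_top_of_le_ne_top ENNReal.one_ne_top ?_
      calc _ ≤ ∫⁻ _, (1 : ℝ≥0∞) ∂(unifOrbit (orbit z)) :=
            lintegral_mono fun w => by split_ifs <;> simp
        _ = 1 := by simp
    have hmi : Measurable fun w : Fin (n + 1) → Z =>
        if w (Fin.last n) = z (Fin.last n) then (1 : ℝ≥0∞) else 0 :=
      hi.comp (measurable_prodMk_left (x := (orbit z, z (Fin.last n))))
    dsimp only
    rw [h1, lintegral_const_mul _ hmi, ENNReal.mul_div_cancel_right h2 h3]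

/-- A law with exchangeable first `n` entries is determined by the joint law of the orbit and the
last entry. -/
lemma FirstExchangeable.ext {Q Q' : Measure (Fin (n + 1) → Z)} (hQ : FirstExchangeable Q)
    (hQ' : FirstExchangeable Q')
    (h : Q.map (fun z => (orbit z, z (Fin.last n))) =
      Q'.map (fun z => (orbit z, z (Fin.last n)))) : Q = Q' := by
  refine Measure.ext_of_lintegral _ fun f hf => ?_
  -- Summing `f` over the stabilizer of the last place multiplies its integral by the order of the
  -- stabilizer and makes it symmetric in the first `n` entries.
  let G : Finset (Equiv.Perm (Fin (n + 1))) :=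
    Finset.univ.filter fun σ => σ (Fin.last n) = Fin.last n
  have hm : ∀ σ : Equiv.Perm (Fin (n + 1)), Measurable fun z => f (z ∘ σ) := fun σ =>
    hf.comp (measurable_comp_perm σ)
  have hsum : ∀ P : Measure (Fin (n + 1) → Z), FirstExchangeable P →
      ∫⁻ z, ∑ σ ∈ G, f (z ∘ σ) ∂P = G.card * ∫⁻ z, f z ∂P := by
    intro P hP
    rw [lintegral_finsetSum _ fun σ _ => hm σ, ← nsmul_eq_mul, ← Finset.sum_const]
    refine Finset.sum_congr rfl fun σ hσ => ?_
    rw [← lintegral_map hf (measurable_comp_perm σ), hP σ (Finset.mem_filter.1 hσ).2]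
  obtain ⟨H, hHm, hH⟩ := exists_measurable_orbit_last (h := fun z => ∑ σ ∈ G, f (z ∘ σ))
    (Finset.measurable_sum _ fun σ _ => hm σ) (by
      intro τ hτ z
      refine Finset.sum_equiv (Equiv.mulLeft τ) (fun σ => ?_) (fun σ _ => rfl)
      simp only [G, Finset.mem_filter, Finset.mem_univ, true_and, Equiv.coe_mulLeft,
        Equiv.Perm.mul_apply]
      constructor
      · intro hσ; rw [hσ, hτ]
      · intro hσ; exact τ.injective (hσ.trans hτ.symm))
  have hG : (G.card : ℝ≥0∞) ≠ 0 := by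
    have : (1 : Equiv.Perm (Fin (n + 1))) ∈ G := by simp [G]
    exact_mod_cast (Finset.card_pos.2 ⟨_, this⟩).ne'
  rw [← ENNReal.mul_right_inj hG (ENNReal.natCast_ne_top _), ← hsum Q hQ, ← hsum Q' hQ']
  simp only [← hH]
  rw [← lintegral_map hHm measurable_orbit_last, h, lintegral_map hHm measurable_orbit_last]

lemma unifEntries_singleton_ne_zero (z : Fin (n + 1) → Z) (i : Fin (n + 1)) :
    unifEntries (orbit z) {z i} ≠ 0 := by
  intro h
  simp only [unifEntries_orbit, Measure.smul_apply, Measure.finsetSum_apply, smul_eq_mul,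
    mul_eq_zero, ENNReal.inv_eq_zero, ENNReal.natCast_ne_top, false_or] at h
  simpa using (Finset.sum_eq_zero_iff.1 h) i (Finset.mem_univ _)

variable {κ : Kernel (Orbit n Z) Z}

/-- Every entry is an atom of `unifEntries`, so the density is determined there exactly. The ratio
of atoms is also visibly measurable in the orbit and the entry together. -/
lemma IsOrbitLaw.lastLR_eq (hκ : IsOrbitLaw κ) (z : Fin (n + 1) → Z) (i : Fin (n + 1)) :
    lastLR κ (orbit z) (z i) = κ (orbit z) {z i} / unifEntries (orbit z) {z i} := by
  have := hκ.1
  have h : κ (orbit z) {z i} =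
      lastLR κ (orbit z) (z i) * unifEntries (orbit z) {z i} := by
    conv_lhs => rw [← Measure.withDensity_rnDeriv_eq _ _ (hκ.2 (orbit z))]
    rw [withDensity_apply _ (measurableSet_singleton _), lintegral_singleton]
    rfl
  rw [h, ENNReal.mul_div_cancel_right (unifEntries_singleton_ne_zero z i) (measure_ne_top _ _)]

lemma IsOrbitLaw.lastLR_ne_top (hκ : IsOrbitLaw κ) (z : Fin (n + 1) → Z) (i : Fin (n + 1)) :
    lastLR κ (orbit z) (z i) ≠ ∞ := by
  have := hκ.1
  rw [hκ.lastLR_eq]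
  exact ENNReal.div_ne_top (measure_ne_top _ _) (unifEntries_singleton_ne_zero z i)

/-- The kernel of uniform distributions on the entries of an orbit. -/
def entriesKernel (n : ℕ) (Z : Type*) [MeasurableSpace Z] : Kernel (Orbit n Z) Z :=
  (unifKernel n Z).map fun w => w (Fin.last n)

lemma entriesKernel_apply (O : Orbit n Z) : entriesKernel n Z O = unifEntries O := by
  rw [entriesKernel, Kernel.map_apply _ (measurable_pi_apply _), unifKernel_apply,
    map_last_unifOrbit]

instance isMarkovKernel_entriesKernel : IsMarkovKernel (entriesKernel n Z) :=
  Kernel.IsMarkovKernel.map _ (measurable_pi_apply _)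

lemma IsOrbitLaw.measurable_lastLR (hκ : IsOrbitLaw κ) (i : Fin (n + 1)) :
    Measurable fun z : Fin (n + 1) → Z => lastLR κ (orbit z) (z i) := by
  have := hκ.1
  have hp : Measurable fun z : Fin (n + 1) → Z => (orbit z, z i) :=
    measurable_orbit.prodMk (measurable_pi_apply _)
  simp only [hκ.lastLR_eq, ← entriesKernel_apply]
  exact ((measurable_kernel_singleton κ).comp hp).div
    ((measurable_kernel_singleton (entriesKernel n Z)).comp hp)

lemma IsOrbitLaw.lintegral_lastLR_mul (hκ : IsOrbitLaw κ) (O : Orbit n Z) {g : Z → ℝ≥0∞}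
    (hg : Measurable g) :
    ∫⁻ w, lastLR κ O (w (Fin.last n)) * g (w (Fin.last n)) ∂(unifOrbit O) =
      ∫⁻ x, g x ∂(κ O) := by
  have := hκ.1
  rw [lintegral_unifOrbit_last O fun x => lastLR κ O x * g x]
  exact lintegral_rnDeriv_mul (hκ.2 O) hg.aemeasurable

lemma IsOrbitLaw.exists_lastLR_ne_zero (hκ : IsOrbitLaw κ) (z : Fin (n + 1) → Z) :
    ∃ i, lastLR κ (orbit z) (z i) ≠ 0 := by
  have := hκ.1
  by_contra! h
  have h1 := hκ.lintegral_lastLR_mul (orbit z) (g := fun _ => 1) measurable_const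
  simp only [mul_one] at h1
  rw [lintegral_unifOrbit_last, lintegral_unifEntries_orbit] at h1
  simp [h] at h1

/-- The mixture over orbits, with mixing law `ν`, of the laws under which the last entry has law
`κ O` and the first `n` entries are exchangeable. -/
def alternative (κ : Kernel (Orbit n Z) Z) (ν : Measure (Orbit n Z)) :
    Measure (Fin (n + 1) → Z) :=
  (orbitMixture ν).withDensity fun z => lastLR κ (orbit z) (z (Fin.last n))

lemma IsOrbitLaw.lintegral_alternative (hκ : IsOrbitLaw κ) (ν : Measure (Orbit n Z))
    {f : (Fin (n + 1) → Z) → ℝ≥0∞} (hf : Measurable f) :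
    ∫⁻ z, f z ∂(alternative κ ν) =
      ∫⁻ z, lastLR κ (orbit z) (z (Fin.last n)) * f z ∂(orbitMixture ν) :=
  lintegral_withDensity_eq_lintegral_mul _ (hκ.measurable_lastLR _) hf

lemma IsOrbitLaw.firstExchangeable_alternative (hκ : IsOrbitLaw κ) (ν : Measure (Orbit n Z)) :
    FirstExchangeable (alternative κ ν) := by
  intro π hπ
  refine Measure.ext_of_lintegral _ fun f hf => ?_
  have hm : Measurable fun z => lastLR κ (orbit z) (z (Fin.last n)) * f z :=
    (hκ.measurable_lastLR _).mul hf
  rw [lintegral_map hf (measurable_comp_perm π), hκ.lintegral_alternative ν hf,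
    hκ.lintegral_alternative ν (f := fun z => f (z ∘ π)) (hf.comp (measurable_comp_perm π))]
  conv_rhs => rw [← exchangeable_orbitMixture ν π, lintegral_map hm (measurable_comp_perm π)]
  simp only [orbit_comp_perm, Function.comp_apply, hπ]

lemma IsOrbitLaw.isAlternative_alternative (hκ : IsOrbitLaw κ) (ν : Measure (Orbit n Z))
    [IsProbabilityMeasure ν] :
    IsAlternative κ (alternative κ ν) ∧ (alternative κ ν).map orbit = ν := by
  have := hκ.1
  obtain ⟨h1, h2, h3⟩ := condDistrib_of_lintegral (κ := κ) (ν := ν) (Q := alternative κ ν) (by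
    intro F hF
    have hFm : Measurable fun z : Fin (n + 1) → Z => F (orbit z, z (Fin.last n)) :=
      hF.comp measurable_orbit_last
    have hm : Measurable fun z : Fin (n + 1) → Z =>
        lastLR κ (orbit z) (z (Fin.last n)) * F (orbit z, z (Fin.last n)) :=
      (hκ.measurable_lastLR _).mul hFm
    rw [hκ.lintegral_alternative ν hFm, lintegral_orbitMixture ν hm]
    refine lintegral_congr fun O => ?_
    rw [← hκ.lintegral_lastLR_mul O (g := fun x => F (O, x)) (hF.comp measurable_prodMk_left)]
    exact lintegral_unifOrbit_congr fun w hw => by simp [hw])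
  exact ⟨⟨h1, hκ.firstExchangeable_alternative ν, h3⟩, h2⟩

lemma IsAlternative.eq_of_map_orbit_eq {Q Q' : Measure (Fin (n + 1) → Z)}
    (hQ : IsAlternative κ Q) (hQ' : IsAlternative κ Q') (h : Q.map orbit = Q'.map orbit) :
    Q = Q' :=
  hQ.first.ext hQ'.first (by rw [hQ.cond.map_eq, hQ'.cond.map_eq, h])

lemma IsAlternative.eq_alternative (hκ : IsOrbitLaw κ) {Q : Measure (Fin (n + 1) → Z)}
    (hQ : IsAlternative κ Q) : Q = alternative κ (Q.map orbit) := by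
  have := hQ.prob
  have : IsProbabilityMeasure (Q.map orbit) :=
    Measure.isProbabilityMeasure_map measurable_orbit.aemeasurable
  obtain ⟨h1, h2⟩ := hκ.isAlternative_alternative (Q.map orbit)
  exact hQ.eq_of_map_orbit_eq h1 h2.symm

/-- A law of the tuple is absolutely continuous with respect to its symmetrization. -/
lemma absolutelyContinuous_orbitMixture (Q : Measure (Fin (n + 1) → Z)) :
    Q ≪ orbitMixture (Q.map orbit) := by
  refine Measure.AbsolutelyContinuous.mk fun s hs h => ?_
  have hm : Measurable (s.indicator (1 : (Fin (n + 1) → Z) → ℝ≥0∞)) := measurable_one.indicator hs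
  rw [← lintegral_indicator_one hs, lintegral_orbitMixture _ hm,
    lintegral_map (measurable_lintegral_unifOrbit hm) measurable_orbit] at h
  refine le_antisymm ?_ bot_le
  calc Q s = ∫⁻ z, s.indicator 1 z ∂Q := (lintegral_indicator_one hs).symm
    -- The identity permutation alone has weight `1 / (n + 1)!` in the orbit mean.
    _ ≤ ∫⁻ z, ((n + 1).factorial : ℝ≥0∞) * ∫⁻ w, s.indicator 1 w ∂(unifOrbit (orbit z)) ∂Q := by
      refine lintegral_mono fun z => ?_
      have hf : ((n + 1).factorial : ℝ≥0∞) ≠ 0 := by simp [Nat.factorial_ne_zero]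
      rw [lintegral_unifOrbit_orbit, ← mul_assoc,
        ENNReal.mul_inv_cancel hf (ENNReal.natCast_ne_top _), one_mul]
      exact Finset.single_le_sum
        (f := fun π : Equiv.Perm (Fin (n + 1)) => s.indicator (1 : (Fin (n + 1) → Z) → ℝ≥0∞) (z ∘ π))
        (fun _ _ => bot_le) (Finset.mem_univ 1)
    _ = 0 := by
      have hmo : Measurable fun z => ∫⁻ w, s.indicator 1 w ∂(unifOrbit (orbit z)) :=
        (measurable_lintegral_unifOrbit hm).comp measurable_orbit
      rw [lintegral_const_mul _ hmo, h, mul_zero]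

/-- Every law of the tuple has a conditional law of the last entry given the orbit that is carried
by the entries of the orbit. -/
lemma exists_isOrbitLaw (Q : Measure (Fin (n + 1) → Z)) [IsProbabilityMeasure Q] :
    ∃ κ : Kernel (Orbit n Z) Z, IsOrbitLaw κ ∧
      HasCondDistrib (fun z : Fin (n + 1) → Z => z (Fin.last n)) orbit κ Q := by
  classical
  set ν := Q.map orbit with hν
  have : IsProbabilityMeasure ν := Measure.isProbabilityMeasure_map measurable_orbit.aemeasurable
  set D := Q.rnDeriv (orbitMixture ν)
  have hDm : Measurable D := Measure.measurable_rnDeriv _ _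
  have hQ : ∀ f : (Fin (n + 1) → Z) → ℝ≥0∞, Measurable f →
      ∫⁻ z, f z ∂Q = ∫⁻ O, ∫⁻ w, D w * f w ∂(unifOrbit O) ∂ν := by
    intro f hf
    rw [← lintegral_rnDeriv_mul (absolutelyContinuous_orbitMixture Q) hf.aemeasurable]
    exact lintegral_orbitMixture ν (f := fun w => D w * f w) (hDm.mul hf)
  have hmm : Measurable fun O => ∫⁻ w, D w ∂(unifOrbit O) := measurable_lintegral_unifOrbit hDm
  -- `Q` and its symmetrization have the same orbit law, so the density averages to one on almost
  -- every orbit.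
  have hone : (fun O => ∫⁻ w, D w ∂(unifOrbit O)) =ᵐ[ν] fun _ => 1 := by
    refine ae_eq_of_forall_setLIntegral_eq_of_sigmaFinite hmm measurable_const fun s hs _ => ?_
    have hi : Measurable (s.indicator (1 : Orbit n Z → ℝ≥0∞)) := measurable_one.indicator hs
    rw [setLIntegral_one, ← lintegral_indicator_one hs, hν, lintegral_map hi measurable_orbit,
      hQ (fun z => s.indicator 1 (orbit z)) (hi.comp measurable_orbit), ← lintegral_indicator hs]
    refine lintegral_congr fun O => ?_
    rw [lintegral_unifOrbit_congr (g := fun w => D w * s.indicator 1 O) fun w hw => by rw [hw],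
      lintegral_mul_const _ hDm]
    by_cases hO : O ∈ s <;> simp [hO]
  let s : Set (Orbit n Z) := {O | ∫⁻ w, D w ∂(unifOrbit O) = 1}
  have hs : MeasurableSet s := hmm (measurableSet_singleton 1)
  have hDu : Measurable (Function.uncurry fun _ : Orbit n Z => D) := hDm.comp measurable_snd
  let κ₀ : Kernel (Orbit n Z) Z :=
    ((unifKernel n Z).withDensity fun _ => D).map fun w => w (Fin.last n)
  have hκ₀ : ∀ O, κ₀ O = ((unifOrbit O).withDensity D).map fun w => w (Fin.last n) := fun O => by
    rw [Kernel.map_apply _ (measurable_pi_apply _), Kernel.withDensity_apply _ hDu,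
      unifKernel_apply]
  -- On the null set of orbits where `D` does not have mean one, the uniform law is substituted, so
  -- that the kernel is Markov and absolutely continuous at every orbit.
  let κ : Kernel (Orbit n Z) Z := Kernel.piecewise hs κ₀ (entriesKernel n Z)
  have hκ_mem : ∀ O ∈ s, κ O = κ₀ O := fun O hO => by simp [κ, Kernel.piecewise_apply, hO]
  have hκ_not : ∀ O ∉ s, κ O = unifEntries O := fun O hO => by
    simp [κ, Kernel.piecewise_apply, hO, entriesKernel_apply]
  have hMarkov : IsMarkovKernel κ := by
    refine ⟨fun O => ?_⟩
    by_cases hO : O ∈ s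
    · refine ⟨?_⟩
      rw [hκ_mem O hO, hκ₀, Measure.map_apply (measurable_pi_apply _) MeasurableSet.univ,
        Set.preimage_univ, withDensity_apply _ MeasurableSet.univ, Measure.restrict_univ]
      exact hO
    · rw [hκ_not O hO]; infer_instance
  refine ⟨κ, ⟨hMarkov, fun O => ?_⟩, (condDistrib_of_lintegral (ν := ν) fun F hF => ?_).2.2⟩
  · by_cases hO : O ∈ s
    · rw [hκ_mem O hO, hκ₀, ← map_last_unifOrbit]
      exact (withDensity_absolutelyContinuous _ _).map (measurable_pi_apply _)
    · rw [hκ_not O hO]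
  · rw [hQ (fun z => F (orbit z, z (Fin.last n))) (hF.comp measurable_orbit_last)]
    refine lintegral_congr_ae (hone.mono fun O hO => ?_)
    have hFO : Measurable fun x => F (O, x) := hF.comp measurable_prodMk_left
    have hFl : Measurable fun w : Fin (n + 1) → Z => F (O, w (Fin.last n)) :=
      hFO.comp (measurable_pi_apply _)
    dsimp only
    rw [hκ_mem O hO, hκ₀, lintegral_map hFO (measurable_pi_apply _),
      lintegral_withDensity_eq_lintegral_mul _ hDm hFl]
    exact lintegral_unifOrbit_congr fun w hw => by simp [hw]

end Alternatives

/-! ### Normalization, validity and optimality of the e-value. -/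

section EValue

variable {Z : Type*} [MeasurableSpace Z] [MeasurableEq Z] {n : ℕ} {U : ℝ≥0∞ → ℝ≥0∞}
  {κ : Kernel (Orbit n Z) Z} {lam : Orbit n Z → ℝ≥0}

lemma lintegral_utilityEValue (z : Fin (n + 1) → Z) :
    ∫⁻ w, utilityEValue U κ lam w ∂(unifOrbit (orbit z)) =
      ((n + 1 : ℕ) : ℝ≥0∞)⁻¹ *
        ∑ i, invDeriv U ((lam (orbit z) : ℝ≥0∞) / lastLR κ (orbit z) (z i)) := by
  rw [← lintegral_unifEntries_orbit z
    fun x => invDeriv U ((lam (orbit z) : ℝ≥0∞) / lastLR κ (orbit z) x),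
    ← lintegral_unifOrbit_last]
  exact lintegral_unifOrbit_congr fun w hw => by rw [utilityEValue, hw]

lemma isNormalizer_iff : IsNormalizer U κ lam ↔ ∀ z : Fin (n + 1) → Z,
    ∑ i, invDeriv U ((lam (orbit z) : ℝ≥0∞) / lastLR κ (orbit z) (z i)) = ((n + 1 : ℕ) : ℝ≥0∞) := by
  have hn : ((n + 1 : ℕ) : ℝ≥0∞) ≠ 0 := by simp
  have ht := ENNReal.natCast_ne_top (n + 1)
  rw [IsNormalizer, orbit_surjective.forall]
  refine forall_congr' fun z => ?_
  rw [lintegral_utilityEValue]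
  constructor
  · intro h
    rw [← mul_one ((n + 1 : ℕ) : ℝ≥0∞), ← h, ← mul_assoc, ENNReal.mul_inv_cancel hn ht, one_mul]
  · intro h
    rw [h, ENNReal.inv_mul_cancel hn ht]

lemma exists_isNormalizer (hU : RegularUtility U) (hκ : IsOrbitLaw κ) :
    ∃ lam : Orbit n Z → ℝ≥0, IsNormalizer U κ lam := by
  have h : ∀ O : Orbit n Z, ∃ l : ℝ≥0, ∀ z, orbit z = O →
      ∑ i, invDeriv U ((l : ℝ≥0∞) / lastLR κ O (z i)) = ((n + 1 : ℕ) : ℝ≥0∞) := by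
    intro O
    obtain ⟨z, rfl⟩ := orbit_surjective O
    obtain ⟨l, hl⟩ := hU.exists_sum_invDeriv_eq (fun i => hκ.lastLR_ne_top z i)
      (hκ.exists_lastLR_ne_zero z) (s := ((n + 1 : ℕ) : ℝ≥0∞)) (by simp)
      (ENNReal.natCast_ne_top _)
    refine ⟨l, fun w hw => ?_⟩
    obtain ⟨π, rfl⟩ := Quotient.exact hw.symm
    rw [← hl]
    exact Equiv.sum_comp π fun i => invDeriv U ((l : ℝ≥0∞) / lastLR κ (orbit z) (z i))
  choose lam hlam using h
  exact ⟨lam, isNormalizer_iff.2 fun z => hlam (orbit z) z rfl⟩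

lemma IsNormalizer.pos (hU : RegularUtility U) (h : IsNormalizer U κ lam) (O : Orbit n Z) :
    0 < lam O := by
  rw [pos_iff_ne_zero]
  intro h0
  obtain ⟨z, rfl⟩ := orbit_surjective O
  have := isNormalizer_iff.1 h z
  refine ENNReal.natCast_ne_top (n + 1) (this.symm.trans (ENNReal.sum_eq_top.2
    ⟨0, Finset.mem_univ _, ?_⟩))
  simp [h0, hU.invDeriv_zero]

/-- By strict monotonicity, `lam ≤ c` holds exactly when the sum with `c` in place of `lam` is at
most `n + 1`, a measurable condition. Hence any normalizer is measurable, however it was chosen. -/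
lemma IsNormalizer.measurable (hU : RegularUtility U) (hκ : IsOrbitLaw κ)
    (h : IsNormalizer U κ lam) : Measurable lam := by
  refine measurable_of_comp_orbit (measurable_of_Iic fun c => ?_)
  have hc : ∀ z : Fin (n + 1) → Z, lam (orbit z) ≤ c ↔
      ∑ i, invDeriv U ((c : ℝ≥0∞) / lastLR κ (orbit z) (z i)) ≤ ((n + 1 : ℕ) : ℝ≥0∞) := by
    intro z
    rw [← isNormalizer_iff.1 h z]
    constructor
    · intro hle
      refine Finset.sum_le_sum fun i _ => hU.invDeriv_strictAnti.antitone ?_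
      exact ENNReal.div_le_div_right (by exact_mod_cast hle) _
    · intro hle
      by_contra! hlt
      refine hle.not_gt (hU.sum_invDeriv_lt (fun i => hκ.lastLR_ne_top z i)
        (hκ.exists_lastLR_ne_zero z) (by exact_mod_cast hlt) ?_)
      exact ne_top_of_le_ne_top (by rw [isNormalizer_iff.1 h z]; exact ENNReal.natCast_ne_top _) hle
  have hm : Measurable fun z : Fin (n + 1) → Z =>
      ∑ i, invDeriv U ((c : ℝ≥0∞) / lastLR κ (orbit z) (z i)) :=
    Finset.measurable_sum _ fun i _ => hU.continuous_invDeriv.measurable.comp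
      (measurable_const.div (hκ.measurable_lastLR i))
  have : (fun z : Fin (n + 1) → Z => lam (orbit z)) ⁻¹' Set.Iic c =
      (fun z => ∑ i, invDeriv U ((c : ℝ≥0∞) / lastLR κ (orbit z) (z i))) ⁻¹'
        Set.Iic ((n + 1 : ℕ) : ℝ≥0∞) := by
    ext z
    exact hc z
  rw [this]
  exact hm measurableSet_Iic

lemma IsNormalizer.isEValue (hU : RegularUtility U) (hκ : IsOrbitLaw κ)
    (h : IsNormalizer U κ lam) : IsEValue (utilityEValue U κ lam) := by
  have hm : Measurable (utilityEValue U κ lam) :=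
    hU.continuous_invDeriv.measurable.comp
      (((h.measurable hU hκ).comp measurable_orbit).coe_nnreal_ennreal.div
        (hκ.measurable_lastLR _))
  refine ⟨hm, fun P hP hex => ?_⟩
  rw [hex.lintegral_eq hm]
  simp [h _]

lemma IsNormalizer.lintegral_utility_le (hU : RegularUtility U) (hκ : IsOrbitLaw κ)
    (h : IsNormalizer U κ lam) {ε' : (Fin (n + 1) → Z) → ℝ≥0∞} (hε' : IsEValue ε')
    (O : Orbit n Z) :
    ∫⁻ w, lastLR κ (orbit w) (w (Fin.last n)) * U (ε' w) ∂(unifOrbit O) ≤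
      ∫⁻ w, lastLR κ (orbit w) (w (Fin.last n)) * U (utilityEValue U κ lam w) ∂(unifOrbit O) := by
  have hε := h.isEValue hU hκ
  -- The tangent inequality is integrated in additive form, so that nothing is subtracted in `[0,
  -- ∞]`; afterwards only the finite constant `lam O` is cancelled.
  have key : ∫⁻ w, (lastLR κ (orbit w) (w (Fin.last n)) * U (ε' w) +
        lam O * utilityEValue U κ lam w) ∂(unifOrbit O) ≤
      ∫⁻ w, (lastLR κ (orbit w) (w (Fin.last n)) * U (utilityEValue U κ lam w) +
        lam O * ε' w) ∂(unifOrbit O) := by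
    refine lintegral_unifOrbit_mono fun w hw => ?_
    -- Each tuple has positive mass on its own orbit, so an e-value is finite everywhere and the
    -- value `U ∞` never matters for competitors.
    have hy : ε' w ≠ ∞ := by
      refine ne_top_of_lintegral_unifOrbit_ne_top (z := w) ?_
      exact ne_top_of_le_ne_top ENNReal.one_ne_top (hε'.lintegral_unifOrbit_le _)
    have := hU.mul_add_le (l := lam O) (by exact_mod_cast (h.pos hU O).ne') ENNReal.coe_ne_top
      (hκ.lastLR_ne_top w (Fin.last n)) hy
    rw [utilityEValue, hw, mul_comm _ (U (ε' w)), mul_comm _ (U (invDeriv U _))]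
    rw [hw] at this
    exact this
  rw [lintegral_add_right _ (hε.measurable.const_mul _), lintegral_const_mul _ hε.measurable,
    lintegral_add_right _ (hε'.measurable.const_mul _), lintegral_const_mul _ hε'.measurable,
    h O, mul_one] at key
  have hle : (lam O : ℝ≥0∞) * ∫⁻ w, ε' w ∂(unifOrbit O) ≤ lam O :=
    mul_le_of_le_one_right' (hε'.lintegral_unifOrbit_le O)
  exact (ENNReal.add_le_add_iff_right ENNReal.coe_ne_top).1 (key.trans (add_le_add le_rfl hle))

lemma IsNormalizer.isOptimalEValue (hU : RegularUtility U) (hκ : IsOrbitLaw κ)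
    (h : IsNormalizer U κ lam) {Q : Measure (Fin (n + 1) → Z)} (hQ : IsAlternative κ Q) :
    IsOptimalEValue U Q (utilityEValue U κ lam) := by
  have hε := h.isEValue hU hκ
  refine ⟨hε, fun ε' hε' => ?_⟩
  have hL := hκ.measurable_lastLR (Fin.last n)
  have hint : ∀ δ : (Fin (n + 1) → Z) → ℝ≥0∞, IsEValue δ → ∫⁻ z, U (δ z) ∂Q =
      ∫⁻ O, ∫⁻ w, lastLR κ (orbit w) (w (Fin.last n)) * U (δ w) ∂(unifOrbit O) ∂(Q.map orbit) := by
    intro δ hδ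
    have hUδ : Measurable fun z => U (δ z) := hU.measurable.comp hδ.measurable
    conv_lhs => rw [hQ.eq_alternative hκ, hκ.lintegral_alternative _ hUδ]
    exact lintegral_orbitMixture _ (hL.mul hUδ)
  rw [hint _ hε', hint _ hε]
  exact lintegral_mono fun O => h.lintegral_utility_le hU hκ hε' O

end EValue

end FuzzyConformal

end

open FuzzyConformal in
theorem mainTheorem3 {Z : Type*} [MeasurableSpace Z] [MeasurableEq Z] (n : ℕ)
    (U : ℝ≥0∞ → ℝ≥0∞) (hU : RegularUtility U) :
    -- every alternative with exchangeable first observations has an orbit-conditional law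
    (∀ Q : Measure (Fin (n + 1) → Z), IsProbabilityMeasure Q → FirstExchangeable Q →
      ∃ κ : Kernel (Orbit n Z) Z, IsOrbitLaw κ ∧ IsAlternative κ Q) ∧
    ∀ κ : Kernel (Orbit n Z) Z, IsOrbitLaw κ →
      -- the alternatives with orbit-conditional law `κ` are the mixtures over orbits
      (∀ ν : Measure (Orbit n Z), IsProbabilityMeasure ν →
        ∃! Q : Measure (Fin (n + 1) → Z), IsAlternative κ Q ∧ Q.map orbit = ν) ∧
      (∃ lam : Orbit n Z → ℝ≥0, IsNormalizer U κ lam) ∧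
      ∀ lam : Orbit n Z → ℝ≥0, IsNormalizer U κ lam →
        (∀ O, 0 < lam O) ∧
        IsEValue (utilityEValue U κ lam) ∧
        -- one and the same e-value is optimal against all of these alternatives
        ∀ Q : Measure (Fin (n + 1) → Z), IsAlternative κ Q →
          IsOptimalEValue U Q (utilityEValue U κ lam) := by
  refine ⟨fun Q hQ hfirst => ?_, fun κ hκ => ⟨fun ν hν => ?_, exists_isNormalizer hU hκ,
    fun lam h => ⟨h.pos hU, h.isEValue hU hκ, fun Q hQ => h.isOptimalEValue hU hκ hQ⟩⟩⟩
  · obtain ⟨κ, hκ, hcond⟩ := exists_isOrbitLaw Q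
    exact ⟨κ, hκ, hQ, hfirst, hcond⟩
  · refine ⟨alternative κ ν, hκ.isAlternative_alternative ν, fun Q hQ => ?_⟩
    rw [← hQ.2]
    exact hQ.1.eq_alternative hκ
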